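/- For a first-order structure $\mathcal A=(A,\dots)$ with at least two elements, let $\widetilde{\mathrm{Def}}(\mathcal A)$ be the commutative semiring of all subsets of $A^n$ ($n\in\mathbb N$ arbitrary) that are definable with parameters from $A$, taken up to bijections whose graph is definable with parameters, where $[D_1]+[D_2]$ is the class of a union of disjoint copies of $D_1$ and $D_2$, $[D_1]\cdot[D_2]=[D_1\times D_2]$, $0=[\emptyset]$, and $1$ is the class of a one-point set. The Grothendieck ring $K_0(\mathcal A)$ is the ring of formal differences of $\widetilde{\mathrm{Def}}(\mathcal A)$, that is, the quotient of $\widetilde{\mathrm{Def}}(\mathcal A)\times\widetilde{\mathrm{Def}}(\mathcal A)$ by the relation $(\alpha,\beta)\sim(\alpha',\beta')$ iff $\alpha+\beta'+\gamma=\alpha'+\beta+\gamma$ for some $\gamma$. Theorem 5.2. Let $\mathcal Q=(Q,<)$ be a nonempty dense linear order without end points, regarded as a structure of the signature $\{<\}$. Let ${}_m\mathcal Q$, $\mathcal Q_M$ and ${}_m\mathcal Q_M$ be the linear orders, also regarded as structures of the signature $\{<\}$, obtained from $\mathcal Q$ by adjoining only a minimum $m$, only a maximum $M$, and both a minimum $m$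 and a maximum $M$, respectively. Then there are ring isomorphisms $$K_0({}_m\mathcal Q)\cong K_0(\mathcal Q),\qquad K_0(\mathcal Q_M)\cong K_0(\mathcal Q),\qquad K_0({}_m\mathcal Q_M)\cong K_0(\mathcal Q).$$ -/

import Mathlib

namespace ModelGrothendieck

open Set

universe u v w

section Definable

variable (L : FirstOrder.Language.{u, v}) {M : Type w} [L.Structure M]

/-- `Def L S` : the set `S` of `α`-tuples from the structure `M` is definable by a first-order
`L`-formula with parameters from `M`. -/
abbrev Def {α : Type*} (S : Set (α → M)) : Prop := (univ : Set M).Definable L S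

/-- There is a definable bijection between the sets of tuples `S` and `T`: a bijection from `S`
onto `T` whose graph `{(x, y) | x ∈ S, y = f x}` is definable with parameters. A pair consisting of
an `α`-tuple and a `β`-tuple is an `(α ⊕ β)`-tuple; for `α = Fin n`, `β = Fin m` this identifies
`Mⁿ × Mᵐ` with `Mⁿ⁺ᵐ`. -/
def DefBij {α β : Type*} (S : Set (α → M)) (T : Set (β → M)) : Prop :=
  ∃ f : (α → M) → (β → M), BijOn f S T ∧
    Def L {v : α ⊕ β → M | v ∘ Sum.inl ∈ S ∧ v ∘ Sum.inr = f (v ∘ Sum.inl)}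

/-- The cartesian product of `S ⊆ Mⁿ` and `T ⊆ Mᵐ` as a subset of `Mⁿ⁺ᵐ`. -/
def prodSet {n m : ℕ} (S : Set (Fin n → M)) (T : Set (Fin m → M)) : Set (Fin (n + m) → M) :=
  {v | v ∘ Fin.castAdd m ∈ S ∧ v ∘ Fin.natAdd n ∈ T}

variable {L}

lemma def_coord_eq {γ : Type*} (i j : γ) : Def L {v : γ → M | v i = v j} :=
  (DefinableFun.proj L).ofPred_eq (DefinableFun.proj L)

lemma def_comp_eq {γ δ : Type*} [Finite δ] (s t : δ → γ) : Def L {v : γ → M | v ∘ s = v ∘ t} := by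
  have : {v : γ → M | v ∘ s = v ∘ t} = ⋂ i, {v : γ → M | v (s i) = v (t i)} := by
    ext v
    simp [funext_iff]
  rw [this]
  exact definable_iInter_of_finite fun i => def_coord_eq _ _

lemma def_singleton {γ : Type*} [Finite γ] (c : γ → M) : Def L ({c} : Set (γ → M)) := by
  have : ({c} : Set (γ → M)) = ⋂ i, {v : γ → M | v i = c i} := by
    ext v
    simp [funext_iff]
  rw [this]
  exact definable_iInter_of_finite fun i =>
    (DefinableFun.proj L).ofPred_eq_const (mem_univ (c i))

lemma def_comp_mem {γ δ : Type*} {S : Set (δ → M)} (hS : Def L S) (s : δ → γ) :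
    Def L {v : γ → M | v ∘ s ∈ S} :=
  hS.preimage_comp s

lemma def_prod {n m : ℕ} {S : Set (Fin n → M)} {T : Set (Fin m → M)} (hS : Def L S)
    (hT : Def L T) : Def L (prodSet S T) :=
  (def_comp_mem hS _).inter (def_comp_mem hT _)

/-- A definable bijection, given as a definable relation. -/
lemma defBij_iff [Nonempty M] {α β : Type*} {S : Set (α → M)} {T : Set (β → M)} :
    DefBij L S T ↔ ∃ R : (α → M) → (β → M) → Prop,
      Def L {v : α ⊕ β → M | R (v ∘ Sum.inl) (v ∘ Sum.inr)} ∧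
      (∀ x y, R x y → x ∈ S ∧ y ∈ T) ∧ (∀ x ∈ S, ∃ y, R x y) ∧ (∀ y ∈ T, ∃ x, R x y) ∧
      (∀ x y y', R x y → R x y' → y = y') ∧ (∀ x x' y, R x y → R x' y → x = x') := by
  classical
  constructor
  · rintro ⟨f, hf, hd⟩
    refine ⟨fun x y => x ∈ S ∧ y = f x, hd, ?_, fun x hx => ⟨f x, hx, rfl⟩, ?_, ?_, ?_⟩
    · rintro x y ⟨hx, rfl⟩
      exact ⟨hx, hf.mapsTo hx⟩
    · intro y hy
      obtain ⟨x, hx, rfl⟩ := hf.surjOn hy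
      exact ⟨x, hx, rfl⟩
    · rintro x y y' ⟨_, rfl⟩ ⟨_, rfl⟩
      rfl
    · rintro x x' y ⟨hx, rfl⟩ ⟨hx', h⟩
      exact hf.injOn hx hx' h
  · rintro ⟨R, hd, hm, ht, hs, hf, hi⟩
    let f : (α → M) → (β → M) := fun x =>
      if h : ∃ y, R x y then h.choose else fun _ => Classical.arbitrary M
    have hR : ∀ x ∈ S, R x (f x) := by
      intro x hx
      have h := ht x hx
      simp only [f, dif_pos h]
      exact h.choose_spec
    refine ⟨f, ⟨fun x hx => (hm _ _ (hR x hx)).2, fun x hx x' hx' h => ?_, fun y hy => ?_⟩, ?_⟩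
    · have h' := hR x' hx'
      rw [← h] at h'
      exact hi _ _ _ (hR x hx) h'
    · obtain ⟨x, hx⟩ := hs y hy
      have hxS := (hm _ _ hx).1
      exact ⟨x, hxS, hf _ _ _ (hR x hxS) hx⟩
    · convert hd using 1
      ext v
      constructor
      · rintro ⟨h1, h2⟩
        have := hR _ h1
        rw [← h2] at this
        exact this
      · intro h
        have h1 := (hm _ _ h).1
        exact ⟨h1, hf _ _ _ h (hR _ h1)⟩

lemma DefBij.refl {α : Type*} [Finite α] {S : Set (α → M)} (hS : Def L S) : DefBij L S S :=
  ⟨id, bijOn_id S, (def_comp_mem hS _).inter (def_comp_eq _ _)⟩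

lemma DefBij.symm [Nonempty M] {α β : Type*} {S : Set (α → M)} {T : Set (β → M)}
    (h : DefBij L S T) : DefBij L T S := by
  obtain ⟨R, hd, hm, ht, hs, hf, hi⟩ := defBij_iff.1 h
  refine defBij_iff.2 ⟨fun y x => R x y, ?_, fun y x h => (hm x y h).symm, hs, ht,
    fun y x x' h h' => hi _ _ _ h h', fun y y' x h h' => hf _ _ _ h h'⟩
  exact hd.preimage_comp Sum.swap

lemma DefBij.trans [Nonempty M] {α β γ : Type*} [Finite β] {S : Set (α → M)} {T : Set (β → M)}
    {U : Set (γ → M)} (h : DefBij L S T) (h' : DefBij L T U) : DefBij L S U := by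
  obtain ⟨R, hd, hm, ht, hs, hf, hi⟩ := defBij_iff.1 h
  obtain ⟨R', hd', hm', ht', hs', hf', hi'⟩ := defBij_iff.1 h'
  refine defBij_iff.2 ⟨fun x z => ∃ y, R x y ∧ R' y z, ?_, ?_, ?_, ?_, ?_, ?_⟩
  · have h1 : Def L {v : (α ⊕ γ) ⊕ β → M |
        R (v ∘ Sum.inl ∘ Sum.inl) (v ∘ Sum.inr) ∧ R' (v ∘ Sum.inr) (v ∘ Sum.inl ∘ Sum.inr)} :=
      (hd.preimage_comp (Sum.elim (Sum.inl ∘ Sum.inl) Sum.inr)).inter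
        (hd'.preimage_comp (Sum.elim Sum.inr (Sum.inl ∘ Sum.inr)))
    exact h1.exists_of_finite
  · rintro x z ⟨y, h1, h2⟩
    exact ⟨(hm _ _ h1).1, (hm' _ _ h2).2⟩
  · intro x hx
    obtain ⟨y, hy⟩ := ht x hx
    obtain ⟨z, hz⟩ := ht' y (hm _ _ hy).2
    exact ⟨z, y, hy, hz⟩
  · intro z hz
    obtain ⟨y, hy⟩ := hs' z hz
    obtain ⟨x, hx⟩ := hs y (hm' _ _ hy).1
    exact ⟨x, y, hx, hy⟩
  · rintro x z z' ⟨y, h1, h2⟩ ⟨y', h1', h2'⟩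
    obtain rfl := hf _ _ _ h1 h1'
    exact hf' _ _ _ h2 h2'
  · rintro x x' z ⟨y, h1, h2⟩ ⟨y', h1', h2'⟩
    obtain rfl := hi' _ _ _ h2 h2'
    exact hi _ _ _ h1 h1'

lemma DefBij.union [Nonempty M] {α β : Type*} {S S' : Set (α → M)} {T T' : Set (β → M)}
    (h : DefBij L S T) (h' : DefBij L S' T') (hS : Disjoint S S') (hT : Disjoint T T') :
    DefBij L (S ∪ S') (T ∪ T') := by
  obtain ⟨R, hd, hm, ht, hs, hf, hi⟩ := defBij_iff.1 h
  obtain ⟨R', hd', hm', ht', hs', hf', hi'⟩ := defBij_iff.1 h'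
  rw [Set.disjoint_left] at hS hT
  refine defBij_iff.2 ⟨fun x y => R x y ∨ R' x y, hd.union hd', ?_, ?_, ?_, ?_, ?_⟩
  · rintro x y (h | h)
    · exact ⟨.inl (hm _ _ h).1, .inl (hm _ _ h).2⟩
    · exact ⟨.inr (hm' _ _ h).1, .inr (hm' _ _ h).2⟩
  · rintro x (h | h)
    · exact (ht x h).imp fun _ => .inl
    · exact (ht' x h).imp fun _ => .inr
  · rintro x (h | h)
    · exact (hs x h).imp fun _ => .inl
    · exact (hs' x h).imp fun _ => .inr
  · rintro x y y' (h | h) (k | k)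
    · exact hf _ _ _ h k
    · exact (hS (hm _ _ h).1 (hm' _ _ k).1).elim
    · exact (hS (hm _ _ k).1 (hm' _ _ h).1).elim
    · exact hf' _ _ _ h k
  · rintro x x' y (h | h) (k | k)
    · exact hi _ _ _ h k
    · exact (hT (hm _ _ h).2 (hm' _ _ k).2).elim
    · exact (hT (hm _ _ k).2 (hm' _ _ h).2).elim
    · exact hi' _ _ _ h k

lemma append_comp_castAdd {n m : ℕ} (x : Fin n → M) (y : Fin m → M) :
    Fin.append x y ∘ Fin.castAdd m = x := by
  ext i
  simp

lemma append_comp_natAdd {n m : ℕ} (x : Fin n → M) (y : Fin m → M) :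
    Fin.append x y ∘ Fin.natAdd n = y := by
  ext i
  simp

lemma fin_add_ext {n m : ℕ} {x y : Fin (n + m) → M}
    (h1 : x ∘ Fin.castAdd m = y ∘ Fin.castAdd m) (h2 : x ∘ Fin.natAdd n = y ∘ Fin.natAdd n) :
    x = y := by
  ext i
  exact Fin.addCases (fun i => congrFun h1 i) (fun i => congrFun h2 i) i

lemma DefBij.prod [Nonempty M] {n m n' m' : ℕ} {S : Set (Fin n → M)} {T : Set (Fin m → M)}
    {S' : Set (Fin n' → M)} {T' : Set (Fin m' → M)} (h : DefBij L S S') (h' : DefBij L T T') :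
    DefBij L (prodSet S T) (prodSet S' T') := by
  obtain ⟨R, hd, hm, ht, hs, hf, hi⟩ := defBij_iff.1 h
  obtain ⟨R', hd', hm', ht', hs', hf', hi'⟩ := defBij_iff.1 h'
  refine defBij_iff.2 ⟨fun x y => R (x ∘ Fin.castAdd m) (y ∘ Fin.castAdd m') ∧
    R' (x ∘ Fin.natAdd n) (y ∘ Fin.natAdd n'), ?_, ?_, ?_, ?_, ?_, ?_⟩
  · exact (hd.preimage_comp (Sum.map (Fin.castAdd m) (Fin.castAdd m'))).inter
      (hd'.preimage_comp (Sum.map (Fin.natAdd n) (Fin.natAdd n')))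
  · rintro x y ⟨h1, h2⟩
    exact ⟨⟨(hm _ _ h1).1, (hm' _ _ h2).1⟩, ⟨(hm _ _ h1).2, (hm' _ _ h2).2⟩⟩
  · rintro x ⟨h1, h2⟩
    obtain ⟨y, hy⟩ := ht _ h1
    obtain ⟨z, hz⟩ := ht' _ h2
    refine ⟨Fin.append y z, ?_, ?_⟩
    · rwa [append_comp_castAdd]
    · rwa [append_comp_natAdd]
  · rintro x ⟨h1, h2⟩
    obtain ⟨y, hy⟩ := hs _ h1
    obtain ⟨z, hz⟩ := hs' _ h2
    refine ⟨Fin.append y z, ?_, ?_⟩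
    · rwa [append_comp_castAdd]
    · rwa [append_comp_natAdd]
  · rintro x y y' ⟨h1, h2⟩ ⟨k1, k2⟩
    exact fin_add_ext (hf _ _ _ h1 k1) (hf' _ _ _ h2 k2)
  · rintro x x' y ⟨h1, h2⟩ ⟨k1, k2⟩
    exact fin_add_ext (hi _ _ _ h1 k1) (hi' _ _ _ h2 k2)

/-- Reordering the coordinates along a bijection of the index types is a definable bijection. -/
lemma DefBij.reindex {α β : Type*} [Finite α] [Finite β] (e : β ≃ α) {S : Set (α → M)}
    {T : Set (β → M)} (hS : Def L S) (h : ∀ x : α → M, x ∈ S ↔ x ∘ e ∈ T) : DefBij L S T := by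
  refine ⟨fun x => x ∘ e, ⟨fun x hx => (h x).1 hx, fun x _ y _ hxy => ?_, fun y hy => ?_⟩, ?_⟩
  · ext i
    simpa using congrFun hxy (e.symm i)
  · refine ⟨y ∘ e.symm, (h _).2 ?_, ?_⟩
    · convert hy
      ext i
      simp
    · ext i
      simp
  · exact (def_comp_mem hS _).inter (def_comp_eq Sum.inr (Sum.inl ∘ e))

lemma DefBij.prod_comm [Nonempty M] {n m : ℕ} {S : Set (Fin n → M)} {T : Set (Fin m → M)}
    (hS : Def L S) (hT : Def L T) : DefBij L (prodSet S T) (prodSet T S) := by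
  let e : Fin (m + n) ≃ Fin (n + m) :=
    finSumFinEquiv.symm.trans ((Equiv.sumComm _ _).trans finSumFinEquiv)
  refine DefBij.reindex e (def_prod hS hT) fun x => ?_
  have h1 : (x ∘ e) ∘ Fin.castAdd n = x ∘ Fin.natAdd n := by
    ext i
    simp [e]
  have h2 : (x ∘ e) ∘ Fin.natAdd m = x ∘ Fin.castAdd m := by
    ext i
    simp [e]
  change _ ∧ _ ↔ (x ∘ e) ∘ Fin.castAdd n ∈ T ∧ (x ∘ e) ∘ Fin.natAdd m ∈ S
  rw [h1, h2, and_comm]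

lemma DefBij.prod_assoc {n m k : ℕ} {S : Set (Fin n → M)} {T : Set (Fin m → M)}
    {U : Set (Fin k → M)} (hS : Def L S) (hT : Def L T) (hU : Def L U) :
    DefBij L (prodSet (prodSet S T) U) (prodSet S (prodSet T U)) := by
  let e : Fin (n + (m + k)) ≃ Fin (n + m + k) := finCongr (by omega)
  refine DefBij.reindex e (def_prod (def_prod hS hT) hU) fun x => ?_
  have h1 : (x ∘ e) ∘ Fin.castAdd (m + k) = (x ∘ Fin.castAdd k) ∘ Fin.castAdd m := by
    ext i
    exact congrArg x (Fin.ext rfl)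
  have h2 : ((x ∘ e) ∘ Fin.natAdd n) ∘ Fin.castAdd k = (x ∘ Fin.castAdd k) ∘ Fin.natAdd n := by
    ext i
    exact congrArg x (Fin.ext rfl)
  have h3 : ((x ∘ e) ∘ Fin.natAdd n) ∘ Fin.natAdd m = x ∘ Fin.natAdd (n + m) := by
    ext i
    exact congrArg x (Fin.ext (by simp [e, add_assoc]))
  change (_ ∧ _) ∧ _ ↔ (x ∘ e) ∘ Fin.castAdd (m + k) ∈ S ∧
    ((x ∘ e) ∘ Fin.natAdd n) ∘ Fin.castAdd k ∈ T ∧ ((x ∘ e) ∘ Fin.natAdd n) ∘ Fin.natAdd m ∈ U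
  rw [h1, h2, h3, and_assoc]

/-- Multiplying with a one-point set is a definable bijection. -/
lemma DefBij.prod_singleton [Nonempty M] {n m : ℕ} {S : Set (Fin n → M)} (hS : Def L S)
    (c : Fin m → M) : DefBij L S (prodSet S {c}) := by
  refine defBij_iff.2 ⟨fun x y => x ∈ S ∧ y ∘ Fin.castAdd m = x ∧ y ∘ Fin.natAdd n = c,
    ?_, ?_, ?_, ?_, ?_, ?_⟩
  · exact (def_comp_mem hS _).inter ((def_comp_eq (Sum.inr ∘ Fin.castAdd m) Sum.inl).inter
      (def_comp_mem (def_singleton c) (Sum.inr ∘ Fin.natAdd n)))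
  · rintro x y ⟨hx, rfl, h⟩
    exact ⟨hx, hx, h⟩
  · intro x hx
    exact ⟨Fin.append x c, hx, append_comp_castAdd _ _, append_comp_natAdd _ _⟩
  · rintro y ⟨h1, h2⟩
    exact ⟨_, h1, rfl, h2⟩
  · rintro x y y' ⟨_, h1, h2⟩ ⟨_, h1', h2'⟩
    exact fin_add_ext (h1.trans h1'.symm) (h2.trans h2'.symm)
  · rintro x x' y ⟨_, h1, h2⟩ ⟨_, h1', h2'⟩
    exact h1.symm.trans h1'

lemma DefBij.singleton {α β : Type*} [Finite α] [Finite β] (c : α → M) (d : β → M) :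
    DefBij L ({c} : Set (α → M)) ({d} : Set (β → M)) := by
  refine ⟨fun _ => d, ⟨fun x _ => rfl, fun x hx y hy _ => ?_, fun y hy => ⟨c, rfl, ?_⟩⟩, ?_⟩
  · exact (mem_singleton_iff.1 hx).trans (mem_singleton_iff.1 hy).symm
  · exact (mem_singleton_iff.1 hy).symm
  · exact (def_comp_mem (def_singleton c) _).inter (def_comp_mem (def_singleton d) _)

lemma DefBij.empty [Nonempty M] {α β : Type*} :
    DefBij L (∅ : Set (α → M)) (∅ : Set (β → M)) :=
  defBij_iff.2 ⟨fun _ _ => False, definable_empty, by simp, by simp, by simp, by simp, by simp⟩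

end Definable

section Semiring

variable (L : FirstOrder.Language.{u, v}) (M : Type w) [L.Structure M]

/-- The collection of all definable subsets of `Mⁿ`, for arbitrary `n`. -/
structure DefSet where
  /-- the number of variables -/
  dim : ℕ
  /-- the underlying set of tuples -/
  carrier : Set (Fin dim → M)
  /-- the set is definable with parameters -/
  isDef : Def L carrier

/-- Definable sets are equivalent when there is a definable bijection between them. -/
instance defSetoid [Nonempty M] : Setoid (DefSet L M) where
  r A B := DefBij L A.carrier B.carrier
  iseqv := ⟨fun A => .refl A.isDef, fun h => h.symm, fun h h' => h.trans h'⟩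

/-- Definable sets up to definable bijection. -/
def DefClass [Nonempty M] : Type w := Quotient (defSetoid L M)

variable {L M}

/-- The class `[S]` of a definable set `S ⊆ Mⁿ`. -/
def cls [Nonempty M] {n : ℕ} (S : Set (Fin n → M)) (hS : Def L S) : DefClass L M :=
  Quotient.mk (defSetoid L M) ⟨n, S, hS⟩

lemma cls_eq_iff [Nonempty M] {n m : ℕ} {S : Set (Fin n → M)} {T : Set (Fin m → M)}
    {hS : Def L S} {hT : Def L T} : cls S hS = cls T hT ↔ DefBij L S T :=
  Quotient.eq

lemma cls_ind [Nonempty M] {P : DefClass L M → Prop}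
    (h : ∀ (n : ℕ) (S : Set (Fin n → M)) (hS : Def L S), P (cls S hS)) (a : DefClass L M) : P a :=
  Quotient.ind (fun A => h A.dim A.carrier A.isDef) a

/-- Two points of `M`, used to make copies of sets disjoint. -/
noncomputable def pt₀ (M : Type w) [Nontrivial M] : M := (exists_pair_ne M).choose

/-- A point of `M` different from `pt₀ M`. -/
noncomputable def pt₁ (M : Type w) [Nontrivial M] : M := (exists_pair_ne M).choose_spec.choose

lemma pt_ne (M : Type w) [Nontrivial M] : pt₀ M ≠ pt₁ M :=
  (exists_pair_ne M).choose_spec.choose_spec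

variable [Nontrivial M]

/-- A copy `S × {(p, …, p)} × {p}` of `S ⊆ Mⁿ` in `Mⁿ⁺ᵐ⁺¹`. -/
def leftCopy {n : ℕ} (m : ℕ) (S : Set (Fin n → M)) : Set (Fin (n + m + 1) → M) :=
  prodSet (prodSet S {fun _ => pt₀ M}) {fun _ => pt₀ M}

/-- A copy `{(p, …, p)} × T × {q}` of `T ⊆ Mᵐ` in `Mⁿ⁺ᵐ⁺¹`, where `p ≠ q`. -/
def rightCopy (n : ℕ) {m : ℕ} (T : Set (Fin m → M)) : Set (Fin (n + m + 1) → M) :=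
  prodSet (prodSet {fun _ => pt₀ M} T) {fun _ => pt₁ M}

lemma def_leftCopy {n : ℕ} (m : ℕ) {S : Set (Fin n → M)} (hS : Def L S) : Def L (leftCopy m S) :=
  def_prod (def_prod hS (def_singleton _)) (def_singleton _)

lemma def_rightCopy (n : ℕ) {m : ℕ} {T : Set (Fin m → M)} (hT : Def L T) :
    Def L (rightCopy n T) :=
  def_prod (def_prod (def_singleton _) hT) (def_singleton _)

lemma bij_leftCopy {n : ℕ} (m : ℕ) {S : Set (Fin n → M)} (hS : Def L S) :
    DefBij L S (leftCopy m S) :=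
  (DefBij.prod_singleton hS _).trans (DefBij.prod_singleton (def_prod hS (def_singleton _)) _)

lemma bij_rightCopy (n : ℕ) {m : ℕ} {T : Set (Fin m → M)} (hT : Def L T) :
    DefBij L T (rightCopy n T) :=
  ((DefBij.prod_singleton hT _).trans (DefBij.prod_comm hT (def_singleton _))).trans
    (DefBij.prod_singleton (def_prod (def_singleton _) hT) _)

lemma disjoint_copies {n m : ℕ} (S : Set (Fin n → M)) (T : Set (Fin m → M)) :
    Disjoint (leftCopy m S) (rightCopy n T) := by
  rw [Set.disjoint_left]
  rintro v ⟨_, h⟩ ⟨_, h'⟩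
  exact pt_ne M (congrFun ((mem_singleton_iff.1 h).symm.trans (mem_singleton_iff.1 h')) 0)

instance : Zero (DefClass L M) := ⟨cls (∅ : Set (Fin 0 → M)) definable_empty⟩

/-- The unit is the class of the one-point set `M⁰`, equivalently (`cls_singleton`) of any
singleton. -/
noncomputable instance : One (DefClass L M) :=
  ⟨cls ({fun i => i.elim0} : Set (Fin 0 → M)) (def_singleton _)⟩

/-- `[A] + [B]` is the class of the union of disjoint copies of `A` and `B`; the lemma
`cls_add_of_disjoint` shows that any disjoint copies give the same result. -/
noncomputable instance : Add (DefClass L M) :=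
  ⟨Quotient.map₂ (fun A B => ⟨A.dim + B.dim + 1, leftCopy B.dim A.carrier ∪
      rightCopy A.dim B.carrier, (def_leftCopy _ A.isDef).union (def_rightCopy _ B.isDef)⟩)
    fun A A' (hA : DefBij L A.carrier A'.carrier) B B' (hB : DefBij L B.carrier B'.carrier) =>
      DefBij.union
        (((bij_leftCopy _ A.isDef).symm.trans hA).trans (bij_leftCopy _ A'.isDef))
        (((bij_rightCopy _ B.isDef).symm.trans hB).trans (bij_rightCopy _ B'.isDef))
        (disjoint_copies _ _) (disjoint_copies _ _)⟩

/-- `[A] · [B] = [A × B]`. -/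
instance : Mul (DefClass L M) :=
  ⟨Quotient.map₂ (fun A B => ⟨A.dim + B.dim, prodSet A.carrier B.carrier,
      def_prod A.isDef B.isDef⟩)
    fun A A' (hA : DefBij L A.carrier A'.carrier) B B' (hB : DefBij L B.carrier B'.carrier) =>
      DefBij.prod hA hB⟩

lemma cls_add {n m : ℕ} {S : Set (Fin n → M)} {T : Set (Fin m → M)} (hS : Def L S)
    (hT : Def L T) : cls S hS + cls T hT =
      cls (leftCopy m S ∪ rightCopy n T) ((def_leftCopy _ hS).union (def_rightCopy _ hT)) := rfl

lemma cls_mul {n m : ℕ} {S : Set (Fin n → M)} {T : Set (Fin m → M)} (hS : Def L S)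
    (hT : Def L T) : cls S hS * cls T hT = cls (prodSet S T) (def_prod hS hT) := rfl

lemma cls_add_of_disjoint {n : ℕ} {S T : Set (Fin n → M)} (hS : Def L S) (hT : Def L T)
    (h : Disjoint S T) : cls S hS + cls T hT = cls (S ∪ T) (hS.union hT) :=
  cls_eq_iff.2 (DefBij.union (bij_leftCopy _ hS).symm (bij_rightCopy _ hT).symm
    (disjoint_copies _ _) h)

lemma cls_singleton {n : ℕ} (c : Fin n → M) :
    cls ({c} : Set (Fin n → M)) (def_singleton c) = (1 : DefClass L M) :=
  cls_eq_iff.2 (DefBij.singleton _ _)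

lemma cls_empty {n : ℕ} :
    cls (∅ : Set (Fin n → M)) definable_empty = (0 : DefClass L M) :=
  cls_eq_iff.2 DefBij.empty

lemma exists_disjoint_reps (a b : DefClass L M) : ∃ (n : ℕ) (S T : Set (Fin n → M))
    (hS : Def L S) (hT : Def L T), Disjoint S T ∧ a = cls S hS ∧ b = cls T hT := by
  induction a using cls_ind with | h n S hS => ?_
  induction b using cls_ind with | h m T hT => ?_
  exact ⟨_, _, _, def_leftCopy m hS, def_rightCopy n hT, disjoint_copies S T,
    cls_eq_iff.2 (bij_leftCopy _ hS), cls_eq_iff.2 (bij_rightCopy _ hT)⟩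

lemma add_comm' (a b : DefClass L M) : a + b = b + a := by
  obtain ⟨n, S, T, hS, hT, hd, rfl, rfl⟩ := exists_disjoint_reps a b
  rw [cls_add_of_disjoint _ _ hd, cls_add_of_disjoint _ _ hd.symm]
  congr 1
  exact union_comm _ _

lemma leftCopy_union {n : ℕ} (m : ℕ) (S T : Set (Fin n → M)) :
    leftCopy m (S ∪ T) = leftCopy m S ∪ leftCopy m T := by
  ext v
  simp only [leftCopy, prodSet, mem_ofPred_eq, mem_union]
  tauto

lemma leftCopy_disjoint {n : ℕ} (m : ℕ) {S T : Set (Fin n → M)} (h : Disjoint S T) :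
    Disjoint (leftCopy m S) (leftCopy m T) := by
  rw [Set.disjoint_left] at h ⊢
  exact fun v hv hv' => h hv.1.1 hv'.1.1

lemma add_assoc' (a b c : DefClass L M) : a + b + c = a + (b + c) := by
  obtain ⟨n, S, T, hS, hT, hd, rfl, rfl⟩ := exists_disjoint_reps a b
  induction c using cls_ind with | h m U hU => ?_
  have e1 : cls S hS = cls _ (def_leftCopy m hS) := cls_eq_iff.2 (bij_leftCopy m hS)
  have e2 : cls T hT = cls _ (def_leftCopy m hT) := cls_eq_iff.2 (bij_leftCopy m hT)
  have e3 : cls _ (hS.union hT) = cls _ (def_leftCopy m (hS.union hT)) :=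
    cls_eq_iff.2 (bij_leftCopy m (hS.union hT))
  have e4 : cls U hU = cls _ (def_rightCopy n hU) := cls_eq_iff.2 (bij_rightCopy n hU)
  rw [cls_add_of_disjoint _ _ hd, e1, e2, e3, e4,
    cls_add_of_disjoint _ _ (disjoint_copies _ _), cls_add_of_disjoint _ _ (disjoint_copies _ _),
    cls_add_of_disjoint]
  · congr 1
    rw [leftCopy_union, union_assoc]
  · exact (leftCopy_disjoint m hd).union_right (disjoint_copies _ _)

lemma zero_add' (a : DefClass L M) : 0 + a = a := by
  induction a using cls_ind with | h n S hS => ?_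
  rw [← cls_empty (n := n), cls_add_of_disjoint _ _ (empty_disjoint _)]
  congr 1
  exact empty_union _

lemma mul_comm' (a b : DefClass L M) : a * b = b * a := by
  induction a using cls_ind with | h n S hS => ?_
  induction b using cls_ind with | h m T hT => ?_
  exact cls_eq_iff.2 (DefBij.prod_comm hS hT)

lemma mul_assoc' (a b c : DefClass L M) : a * b * c = a * (b * c) := by
  induction a using cls_ind with | h n S hS => ?_
  induction b using cls_ind with | h m T hT => ?_
  induction c using cls_ind with | h k U hU => ?_
  exact cls_eq_iff.2 (DefBij.prod_assoc hS hT hU)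

lemma mul_one' (a : DefClass L M) : a * 1 = a := by
  induction a using cls_ind with | h n S hS => ?_
  exact (cls_eq_iff.2 (DefBij.prod_singleton hS _)).symm

lemma zero_mul' (a : DefClass L M) : 0 * a = 0 := by
  induction a using cls_ind with | h n S hS => ?_
  refine Eq.trans (b := cls (prodSet ∅ S) (def_prod definable_empty hS)) rfl
    (Eq.trans ?_ (cls_empty (n := 0 + n)))
  congr 1
  ext v
  simp [prodSet]

lemma add_mul' (a b c : DefClass L M) : (a + b) * c = a * c + b * c := by
  obtain ⟨n, S, T, hS, hT, hd, rfl, rfl⟩ := exists_disjoint_reps a b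
  induction c using cls_ind with | h m U hU => ?_
  rw [cls_add_of_disjoint _ _ hd, cls_mul, cls_mul, cls_mul, cls_add_of_disjoint]
  · congr 1
    ext v
    simp only [prodSet, mem_ofPred_eq, mem_union]
    tauto
  · rw [Set.disjoint_left] at hd ⊢
    exact fun v hv hv' => hd hv.1 hv'.1

/-- The semiring of definable sets up to definable bijection. -/
noncomputable instance : CommSemiring (DefClass L M) where
  add_assoc := add_assoc'
  zero_add := zero_add'
  add_zero a := (add_comm' a 0).trans (zero_add' a)
  add_comm := add_comm'
  nsmul := nsmulRec
  mul_assoc := mul_assoc'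
  one_mul a := (mul_comm' 1 a).trans (mul_one' a)
  mul_one := mul_one'
  zero_mul := zero_mul'
  mul_zero a := (mul_comm' a 0).trans (zero_mul' a)
  left_distrib a b c := by
    rw [mul_comm' a, mul_comm' a, mul_comm' a, add_mul']
  right_distrib := add_mul'
  mul_comm := mul_comm'

end Semiring

section GrothendieckRing

variable (R : Type w) [CommSemiring R]

/-- The equivalence relation on pairs (formal differences) of elements of a semiring:
`(α, β) ∼ (α', β')` iff `α + β' + γ = α' + β + γ` for some `γ`. -/
def diffSetoid : Setoid (R × R) where
  r x y := ∃ c : R, x.1 + y.2 + c = y.1 + x.2 + c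
  iseqv := by
    refine ⟨fun x => ⟨0, rfl⟩, ?_, ?_⟩
    · rintro x y ⟨c, h⟩
      exact ⟨c, h.symm⟩
    · rintro ⟨a, b⟩ ⟨a', b'⟩ ⟨a'', b''⟩ ⟨c, h⟩ ⟨d, k⟩
      refine ⟨b' + a' + c + d, ?_⟩
      dsimp only at h k ⊢
      calc a + b'' + (b' + a' + c + d) = (a + b' + c) + (a' + b'' + d) := by ring
        _ = (a' + b + c) + (a'' + b' + d) := by rw [h, k]
        _ = a'' + b + (b' + a' + c + d) := by ring

/-- The Grothendieck ring of a commutative semiring, the ring of formal differences. -/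
def GrothendieckRing : Type w := Quotient (diffSetoid R)

namespace GrothendieckRing

variable {R}

/-- The formal difference `a - b`. -/
def diff (a b : R) : GrothendieckRing R := Quotient.mk (diffSetoid R) (a, b)

lemma diff_eq_iff {a b a' b' : R} :
    diff a b = diff a' b' ↔ ∃ c, a + b' + c = a' + b + c :=
  Quotient.eq

instance : Zero (GrothendieckRing R) := ⟨diff 0 0⟩

instance : One (GrothendieckRing R) := ⟨diff 1 0⟩

instance : Neg (GrothendieckRing R) :=
  ⟨Quotient.map (fun x => (x.2, x.1)) (by
    rintro ⟨a, b⟩ ⟨a', b'⟩ ⟨c, h⟩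
    refine ⟨c, ?_⟩
    dsimp only at h ⊢
    rw [add_comm b, add_comm b', h])⟩

instance : Add (GrothendieckRing R) :=
  ⟨Quotient.map₂ (fun x y => (x.1 + y.1, x.2 + y.2)) (by
    rintro ⟨a, b⟩ ⟨a', b'⟩ ⟨c, h⟩ ⟨p, q⟩ ⟨p', q'⟩ ⟨d, k⟩
    refine ⟨c + d, ?_⟩
    dsimp only at h k ⊢
    calc a + p + (b' + q') + (c + d) = (a + b' + c) + (p + q' + d) := by ring
      _ = (a' + b + c) + (p' + q + d) := by rw [h, k]
      _ = a' + p' + (b + q) + (c + d) := by ring)⟩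

instance : Mul (GrothendieckRing R) :=
  ⟨Quotient.map₂ (fun x y => (x.1 * y.1 + x.2 * y.2, x.1 * y.2 + x.2 * y.1)) (by
    rintro ⟨a, b⟩ ⟨a', b'⟩ ⟨c, h⟩ ⟨p, q⟩ ⟨p', q'⟩ ⟨d, k⟩
    refine ⟨c * p + c * q + a' * d + b' * d + a' * p + b' * q + a' * q + b' * p, ?_⟩
    dsimp only at h k ⊢
    calc a * p + b * q + (a' * q' + b' * p') +
          (c * p + c * q + a' * d + b' * d + a' * p + b' * q + a' * q + b' * p)
        = (a + b' + c) * p + (a' + b + c) * q + a' * (p + q' + d) + b' * (p' + q + d) := by ring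
      _ = (a' + b + c) * p + (a + b' + c) * q + a' * (p' + q + d) + b' * (p + q' + d) := by
          rw [h, k]
      _ = a' * p' + b' * q' + (a * q + b * p) +
          (c * p + c * q + a' * d + b' * d + a' * p + b' * q + a' * q + b' * p) := by ring)⟩

lemma diff_add (a b p q : R) : diff a b + diff p q = diff (a + p) (b + q) := rfl

lemma diff_mul (a b p q : R) : diff a b * diff p q = diff (a * p + b * q) (a * q + b * p) := rfl

lemma neg_diff (a b : R) : -diff a b = diff b a := rfl

lemma diff_ind {P : GrothendieckRing R → Prop} (h : ∀ a b, P (diff a b))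
    (x : GrothendieckRing R) : P x :=
  Quotient.ind (fun y => h y.1 y.2) x

lemma diff_congr {a b a' b' : R} (h : a + b' = a' + b) : diff a b = diff a' b' :=
  diff_eq_iff.2 ⟨0, by rw [h]⟩

instance : CommRing (GrothendieckRing R) where
  add_assoc x y z := by
    induction x using diff_ind with | h a b => ?_
    induction y using diff_ind with | h c d => ?_
    induction z using diff_ind with | h e f => ?_
    simp only [diff_add]
    exact diff_congr (by ring)
  zero_add x := by
    induction x using diff_ind with | h a b => ?_
    exact diff_congr (by ring)
  add_zero x := by
    induction x using diff_ind with | h a b => ?_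
    exact diff_congr (by ring)
  add_comm x y := by
    induction x using diff_ind with | h a b => ?_
    induction y using diff_ind with | h c d => ?_
    exact diff_congr (by ring)
  neg_add_cancel x := by
    induction x using diff_ind with | h a b => ?_
    exact diff_congr (by ring)
  nsmul := nsmulRec
  zsmul := zsmulRec
  mul_assoc x y z := by
    induction x using diff_ind with | h a b => ?_
    induction y using diff_ind with | h c d => ?_
    induction z using diff_ind with | h e f => ?_
    exact diff_congr (by ring)
  one_mul x := by
    induction x using diff_ind with | h a b => ?_
    exact diff_congr (by ring)
  mul_one x := by
    induction x using diff_ind with | h a b => ?_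
    exact diff_congr (by ring)
  zero_mul x := by
    induction x using diff_ind with | h a b => ?_
    exact diff_congr (by ring)
  mul_zero x := by
    induction x using diff_ind with | h a b => ?_
    exact diff_congr (by ring)
  left_distrib x y z := by
    induction x using diff_ind with | h a b => ?_
    induction y using diff_ind with | h c d => ?_
    induction z using diff_ind with | h e f => ?_
    exact diff_congr (by ring)
  right_distrib x y z := by
    induction x using diff_ind with | h a b => ?_
    induction y using diff_ind with | h c d => ?_
    induction z using diff_ind with | h e f => ?_
    exact diff_congr (by ring)
  mul_comm x y := by
    induction x using diff_ind with | h a b => ?_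
    induction y using diff_ind with | h c d => ?_
    exact diff_congr (by ring)

end GrothendieckRing

end GrothendieckRing

/-- The Grothendieck ring `K₀(M)` of a first-order structure `M` (with at least two elements). -/
abbrev K₀ (L : FirstOrder.Language.{u, v}) (M : Type w) [L.Structure M] [Nontrivial M] : Type w :=
  GrothendieckRing (DefClass L M)

section Order

/-- The relation symbols of the signature `{<}`: one binary symbol. -/
inductive LtRel : ℕ → Type
  | lt : LtRel 2

/-- The signature `{<}`. -/
def ltLang : FirstOrder.Language.{0, 0} := ⟨fun _ => Empty, LtRel⟩

/-- Every type with a strict order relation is a structure of the signature `{<}`. -/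
instance ltStructure (M : Type w) [LT M] : ltLang.Structure M where
  funMap := fun f _ => f.elim
  RelMap := fun r => match r with
    | LtRel.lt => fun x => x 0 < x 1

end Order

end ModelGrothendieck

/-!
Adjoining an end point to a linear order does not change what can be defined, up to definable
bijection: the two orders are bi-interpretable with parameters. Indeed `Q` is the definable subset
`{x | x ≠ m}` of `WithBot Q` with the induced order. Conversely, if `a ≠ b` are elements of `Q`,
then `x ↦ (x, a)`, `m ↦ (a, b)` identifies `WithBot Q` with a definable subset of `Q²` on which the
order is definable.

An interpretation by an injective map `i : M → Nᵏ` (`IsCoding`) sends a definable set of tuples to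
the definable set of their codes. Graphs of definable bijections, disjoint unions and products are
respected, so it induces an additive and multiplicative map of the semirings of definable classes
(`IsCoding.classMap`). If the composite of two such interpretations `M → N → M` has a definable
graph, this graph provides definable bijections between definable sets and their double codes, so
the induced maps compose to the identity (`IsCoding.classMap_classMap`). Two mutually inverse
interpretations therefore give an isomorphism of semirings (`defClassEquiv`), hence of Grothendieck
rings.

That a map is an interpretation is checked on the relation symbols only
(`isCoding_of_isRelational`): formulas are translated by restricting quantifiers to the definable
set of codes. The argument needs neither density nor quantifier elimination, and works for any order
with two elements and any new point that compares in the same way with all the old elements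
(`nonempty_K₀_equiv_of_adjoin_point`). For a minimum and a maximum it is applied twice.
-/

namespace ModelGrothendieck

open Set FirstOrder FirstOrder.Language

universe u v w u' v' w'

/-! ### Tuples of coded elements -/

section TupleMap

variable {M N α β κ : Type*}

/-- Given a coding `i` of the elements of `M` by `κ`-tuples from `N`, code an `α`-tuple from `M` by
an `α × κ`-tuple from `N`. -/
def tupleMap (i : M → κ → N) (x : α → M) : α × κ → N := fun p => i (x p.1) p.2

lemma tupleMap_injective {i : M → κ → N} (hi : Function.Injective i) :
    Function.Injective (tupleMap i : (α → M) → α × κ → N) := fun _ _ h =>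
  funext fun a => hi (funext fun k => congrFun h (a, k))

/-- The preimage of a definable set remains definable when each block of `κ` coordinates is either
one of the blocks of `w` or the code of a fixed element of `M`. -/
lemma def_subst {L' : FirstOrder.Language.{u', v'}} [L'.Structure N] [Finite κ] [Finite β]
    (i : M → κ → N) {T : Set (β × κ → N)} (hT : Def L' T) (τ : β → M ⊕ α) :
    Def L' {w : α × κ → N |
      (fun p : β × κ => Sum.elim (fun c => i c p.2) (fun a => w (a, p.2)) (τ p.1)) ∈ T} := by
  refine hT.preimage_map (F := fun (w : α × κ → N) (p : β × κ) =>
    Sum.elim (fun c => i c p.2) (fun a => w (a, p.2)) (τ p.1)) fun p => ?_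
  rcases h : τ p.1 with c | a
  · simpa only [h] using! L'.definableFun_const (α × κ) (mem_univ (i c p.2))
  · simpa only [h] using! DefinableFun.proj L' (i := (a, p.2))

lemma tupleMap_subst (i : M → κ → N) (τ : β → M ⊕ α) (x : α → M) :
    tupleMap i (fun b => Sum.elim id x (τ b)) = fun p : β × κ =>
      Sum.elim (fun c => i c p.2) (fun a => tupleMap i x (a, p.2)) (τ p.1) := by
  funext p
  rcases h : τ p.1 with c | a <;> simp [tupleMap, h]

end TupleMap

/-! ### Codings of one structure in another -/

section Coding

variable (L : FirstOrder.Language.{u, v}) (L' : FirstOrder.Language.{u', v'})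
  {M : Type w} [L.Structure M] {N : Type w'} [L'.Structure N] {κ : Type}

/-- The injective map `i` codes the elements of the `L`-structure `M` by `κ`-tuples from the
`L'`-structure `N` in such a way that the codes of the tuples of a definable set form a definable
set. This is an injective interpretation of `M` in `N` with parameters. -/
structure IsCoding (i : M → κ → N) : Prop where
  injective : Function.Injective i
  def_image : ∀ {α : Type} [Finite α] {S : Set (α → M)}, Def L S → Def L' (tupleMap i '' S)

variable {L L'}

/-- In a relational language every term is a variable; after evaluation of the parameters it is
therefore an element of the structure or a variable. -/
lemma exists_realize_term [L.IsRelational] {α : Type*} {n : ℕ}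
    (t : L.Term (((univ : Set M) ⊕ α) ⊕ Fin n)) :
    ∃ τ : M ⊕ (α ⊕ Fin n), ∀ (x : α → M) (y : Fin n → M),
      t.realize (Sum.elim (Sum.elim (↑) x) y) = Sum.elim id (Sum.elim x y) τ := by
  rcases t with ((c | a) | j) | ⟨f, _⟩
  · exact ⟨.inl c, fun _ _ => rfl⟩
  · exact ⟨.inr (.inl a), fun _ _ => rfl⟩
  · exact ⟨.inr (.inr j), fun _ _ => rfl⟩
  · exact isEmptyElim f

lemma def_range_tupleMap [Finite κ] {i : M → κ → N} (hr : Def L' (range i))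
    (α : Type*) [Finite α] : Def L' (range (tupleMap i : (α → M) → α × κ → N)) := by
  have h : range (tupleMap i : (α → M) → α × κ → N) =
      ⋂ a, {w : α × κ → N | (w ∘ fun k => (a, k)) ∈ range i} := by
    ext w
    simp only [mem_range, mem_iInter, mem_ofPred_eq]
    constructor
    · rintro ⟨x, rfl⟩ a
      exact ⟨x a, rfl⟩
    · intro h
      choose x hx using h
      exact ⟨x, funext fun p => congrFun (hx p.1) p.2⟩
  rw [h]
  exact definable_iInter_of_finite fun a => def_comp_mem hr _

/-- The translation of formulas along a coding: equality becomes equality of codes, relations become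
the definable sets of codes, and quantifiers are restricted to the set of codes. -/
lemma exists_def_translation [L.IsRelational] [Finite κ] {i : M → κ → N}
    (hi : Function.Injective i) (hr : Def L' (range i))
    (hrel : ∀ (n : ℕ) (r : L.Relations n), ∃ T : Set (Fin n × κ → N), Def L' T ∧
      ∀ x, Structure.RelMap r x ↔ tupleMap i x ∈ T)
    {α : Type*} {n : ℕ} (φ : L.BoundedFormula ((univ : Set M) ⊕ α) n) :
    ∃ T : Set ((α ⊕ Fin n) × κ → N), Def L' T ∧ ∀ (x : α → M) (y : Fin n → M),
      φ.Realize (Sum.elim (↑) x) y ↔ tupleMap i (Sum.elim x y) ∈ T := by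
  induction φ with
  | falsum => exact ⟨∅, definable_empty, fun x y => Iff.rfl⟩
  | equal t₁ t₂ =>
    obtain ⟨τ₁, h₁⟩ := exists_realize_term t₁
    obtain ⟨τ₂, h₂⟩ := exists_realize_term t₂
    have hT : Def L' {w : Bool × κ → N | (w ∘ fun k => (true, k)) = w ∘ fun k => (false, k)} :=
      def_comp_eq _ _
    refine ⟨_, def_subst i hT (fun b => cond b τ₁ τ₂), fun x y => ?_⟩
    rw [mem_ofPred_eq, ← tupleMap_subst i (fun b => cond b τ₁ τ₂) (Sum.elim x y),
      BoundedFormula.Realize, h₁, h₂]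
    exact hi.eq_iff.symm
  | rel r ts =>
    choose τ hτ using fun l => exists_realize_term (ts l)
    obtain ⟨T, hT, h⟩ := hrel _ r
    refine ⟨_, def_subst i hT τ, fun x y => ?_⟩
    rw [mem_ofPred_eq, ← tupleMap_subst i τ (Sum.elim x y), ← h, BoundedFormula.Realize]
    simp only [hτ]
  | imp φ ψ ihφ ihψ =>
    obtain ⟨T, hT, h⟩ := ihφ
    obtain ⟨U, hU, k⟩ := ihψ
    refine ⟨Tᶜ ∪ U, hT.compl.union hU, fun x y => ?_⟩
    rw [BoundedFormula.realize_imp, h, k, mem_union, mem_compl_iff, imp_iff_not_or]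
  | @all n φ ih =>
    obtain ⟨T, hT, h⟩ := ih
    -- the last block of coordinates becomes the quantified one
    let s : (α ⊕ Fin (n + 1)) × κ → ((α ⊕ Fin n) × κ) ⊕ κ := fun p =>
      Sum.elim (fun a => .inl (.inl a, p.2))
        (fun j => Fin.lastCases (.inr p.2) (fun j' => .inl (.inr j', p.2)) j) p.1
    have hs : ∀ (x : α → M) (y : Fin n → M) (z : M),
        Sum.elim (tupleMap i (Sum.elim x y)) (i z) ∘ s =
          tupleMap i (Sum.elim x (Fin.snoc y z)) := by
      intro x y z
      funext ⟨a, k⟩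
      rcases a with a | j
      · rfl
      · induction j using Fin.lastCases <;> simp [s, tupleMap]
    refine ⟨_, ((def_comp_mem hr Sum.inr).compl.union (def_comp_mem hT s)).forall_of_finite,
      fun x y => ?_⟩
    simp only [BoundedFormula.realize_all, h, mem_ofPred_eq, mem_union, mem_compl_iff,
      Sum.elim_comp_inr, ← imp_iff_not_or]
    constructor
    · rintro H _ ⟨z, rfl⟩
      rw [hs]
      exact H z
    · intro H z
      rw [← hs]
      exact H _ ⟨z, rfl⟩

/-- For a relational language it is enough that the set of codes and the relations on codes are
definable. -/
lemma isCoding_of_isRelational [L.IsRelational] [Finite κ] {i : M → κ → N}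
    (hi : Function.Injective i) (hr : Def L' (range i))
    (hrel : ∀ (n : ℕ) (r : L.Relations n), ∃ T : Set (Fin n × κ → N), Def L' T ∧
      ∀ x, Structure.RelMap r x ↔ tupleMap i x ∈ T) : IsCoding L L' i := by
  refine ⟨hi, fun {α} _ {S} hS => ?_⟩
  obtain ⟨φ, rfl⟩ := definable_iff_exists_formula_sum.1 hS
  obtain ⟨T, hT, h⟩ := exists_def_translation hi hr hrel φ
  convert (def_range_tupleMap hr α).inter
    (def_comp_mem hT fun p => (Sum.elim id Fin.elim0 p.1, p.2)) using 1
  have hx : ∀ x : α → M, (tupleMap i x ∘ fun p : (α ⊕ Fin 0) × κ =>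
      (Sum.elim id Fin.elim0 p.1, p.2)) = tupleMap i (Sum.elim x default) := by
    intro x
    funext ⟨a, k⟩
    rcases a with a | j
    · rfl
    · exact j.elim0
  ext w
  constructor
  · rintro ⟨x, hφ, rfl⟩
    refine ⟨⟨x, rfl⟩, ?_⟩
    rw [mem_ofPred_eq, hx]
    exact (h _ _).1 hφ
  · rintro ⟨⟨x, rfl⟩, hw⟩
    rw [mem_ofPred_eq, hx] at hw
    exact ⟨x, (h _ _).2 hw, rfl⟩

/-- Codings preserve definable bijections, since they preserve definability of graphs. -/
lemma IsCoding.defBij [Nonempty M] [Nonempty N] {i : M → κ → N} (hi : IsCoding L L' i)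
    {α β : Type} [Finite α] [Finite β] {S : Set (α → M)} {T : Set (β → M)} (h : DefBij L S T) :
    DefBij L' (tupleMap i '' S) (tupleMap i '' T) := by
  obtain ⟨R, hd, hm, ht, hs, hf, hi'⟩ := defBij_iff.1 h
  refine defBij_iff.2 ⟨fun x y => ∃ a b, R a b ∧ tupleMap i a = x ∧ tupleMap i b = y,
    ?_, ?_, ?_, ?_, ?_, ?_⟩
  · convert (hi.def_image hd).preimage_comp (Equiv.sumProdDistrib α β κ) using 1
    ext v
    constructor
    · rintro ⟨a, b, hab, h1, h2⟩
      refine ⟨Sum.elim a b, hab, ?_⟩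
      funext ⟨c, k⟩
      rcases c with c | c
      · exact congrFun h1 (c, k)
      · exact congrFun h2 (c, k)
    · rintro ⟨c, hc, h⟩
      exact ⟨_, _, hc, funext fun p => congrFun h (.inl p.1, p.2),
        funext fun p => congrFun h (.inr p.1, p.2)⟩
  · rintro _ _ ⟨a, b, h, rfl, rfl⟩
    exact ⟨⟨a, (hm _ _ h).1, rfl⟩, ⟨b, (hm _ _ h).2, rfl⟩⟩
  · rintro _ ⟨a, ha, rfl⟩
    obtain ⟨b, hb⟩ := ht a ha
    exact ⟨_, a, b, hb, rfl, rfl⟩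
  · rintro _ ⟨b, hb, rfl⟩
    obtain ⟨a, ha⟩ := hs b hb
    exact ⟨_, a, b, ha, rfl, rfl⟩
  · rintro _ _ _ ⟨a, b, h, rfl, rfl⟩ ⟨a', b', h', e, rfl⟩
    obtain rfl := tupleMap_injective hi.injective e
    rw [hf _ _ _ h h']
  · rintro _ _ _ ⟨a, b, h, rfl, rfl⟩ ⟨a', b', h', rfl, e⟩
    obtain rfl := tupleMap_injective hi.injective e
    rw [hi' _ _ _ h h']

end Coding

/-! ### Classes of definable sets of tuples with arbitrary finite index types -/

section ClassOf

variable {L : FirstOrder.Language.{u, v}} {M : Type w} [L.Structure M]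

/-- The class of a definable set of `α`-tuples, for an arbitrary finite index type `α`, obtained
by numbering the elements of `α`. -/
noncomputable def clsOf [Nonempty M] {α : Type} [Finite α] (S : Set (α → M)) (hS : Def L S) :
    DefClass L M :=
  cls {x : Fin (Nat.card α) → M | x ∘ Finite.equivFin α ∈ S} (def_comp_mem hS _)

lemma defBij_clsOf {α : Type} [Finite α] {S : Set (α → M)} (hS : Def L S) :
    DefBij L {x : Fin (Nat.card α) → M | x ∘ Finite.equivFin α ∈ S} S :=
  .reindex (Finite.equivFin α) (def_comp_mem hS _) fun _ => Iff.rfl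

lemma clsOf_eq_iff [Nonempty M] {α β : Type} [Finite α] [Finite β] {S : Set (α → M)}
    {T : Set (β → M)} {hS : Def L S} {hT : Def L T} : clsOf S hS = clsOf T hT ↔ DefBij L S T :=
  cls_eq_iff.trans ⟨fun h => ((defBij_clsOf hS).symm.trans h).trans (defBij_clsOf hT),
    fun h => ((defBij_clsOf hS).trans h).trans (defBij_clsOf hT).symm⟩

lemma clsOf_eq_cls [Nonempty M] {n : ℕ} {S : Set (Fin n → M)} (hS : Def L S) :
    clsOf S hS = cls S hS :=
  cls_eq_iff.2 (defBij_clsOf hS)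

variable [Nontrivial M]

lemma clsOf_union {α : Type} [Finite α] {S T : Set (α → M)} (hS : Def L S) (hT : Def L T)
    (h : Disjoint S T) : clsOf (S ∪ T) (hS.union hT) = clsOf S hS + clsOf T hT := by
  unfold clsOf
  rw [cls_add_of_disjoint]
  · rfl
  · exact h.preimage fun x : Fin (Nat.card α) → M => x ∘ Finite.equivFin α

lemma clsOf_mul {α β : Type} [Finite α] [Finite β] {S : Set (α → M)} {T : Set (β → M)}
    (hS : Def L S) (hT : Def L T) :
    clsOf {v : α ⊕ β → M | v ∘ Sum.inl ∈ S ∧ v ∘ Sum.inr ∈ T}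
      ((def_comp_mem hS _).inter (def_comp_mem hT _)) = clsOf S hS * clsOf T hT := by
  have hST : Def L {v : α ⊕ β → M | v ∘ Sum.inl ∈ S ∧ v ∘ Sum.inr ∈ T} :=
    (def_comp_mem hS _).inter (def_comp_mem hT _)
  refine cls_eq_iff.2 ((defBij_clsOf hST).trans (DefBij.reindex (finSumFinEquiv.symm.trans
    ((Finite.equivFin α).symm.sumCongr (Finite.equivFin β).symm)) hST fun v => and_congr ?_ ?_))
  · refine iff_of_eq (congrArg (· ∈ S) (funext fun a => ?_))
    simp
  · refine iff_of_eq (congrArg (· ∈ T) (funext fun a => ?_))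
    simp

end ClassOf

/-! ### The maps induced by codings -/

section Induced

variable {L : FirstOrder.Language.{u, v}} {L' : FirstOrder.Language.{u', v'}}
  {M : Type w} [L.Structure M] [Nontrivial M] {N : Type w'} [L'.Structure N] [Nontrivial N]
  {κ lam : Type} [Finite κ] [Finite lam]

/-- The map on classes of definable sets that sends a set to the set of the codes of its
tuples. -/
noncomputable def IsCoding.classMap {i : M → κ → N} (hi : IsCoding L L' i) :
    DefClass L M → DefClass L' N :=
  Quotient.lift (fun A => clsOf (tupleMap i '' A.carrier) (hi.def_image A.isDef))
    fun _ _ h => clsOf_eq_iff.2 (hi.defBij h)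

lemma IsCoding.classMap_cls {i : M → κ → N} (hi : IsCoding L L' i) {n : ℕ} {S : Set (Fin n → M)}
    (hS : Def L S) : hi.classMap (cls S hS) = clsOf (tupleMap i '' S) (hi.def_image hS) := rfl

lemma IsCoding.classMap_clsOf {i : M → κ → N} (hi : IsCoding L L' i) {α : Type} [Finite α]
    {S : Set (α → M)} (hS : Def L S) :
    hi.classMap (clsOf S hS) = clsOf (tupleMap i '' S) (hi.def_image hS) :=
  (hi.classMap_cls _).trans (clsOf_eq_iff.2 (hi.defBij (defBij_clsOf hS)))

lemma IsCoding.classMap_add {i : M → κ → N} (hi : IsCoding L L' i) (a b : DefClass L M) :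
    hi.classMap (a + b) = hi.classMap a + hi.classMap b := by
  obtain ⟨n, S, T, hS, hT, hd, rfl, rfl⟩ := exists_disjoint_reps a b
  rw [cls_add_of_disjoint _ _ hd, classMap_cls, classMap_cls, classMap_cls, ← clsOf_union]
  · congr 1
    exact image_union _ _ _
  · exact disjoint_image_of_injective (tupleMap_injective hi.injective) hd

lemma IsCoding.classMap_mul {i : M → κ → N} (hi : IsCoding L L' i) (a b : DefClass L M) :
    hi.classMap (a * b) = hi.classMap a * hi.classMap b := by
  induction a using cls_ind with | h n S hS => ?_
  induction b using cls_ind with | h m T hT => ?_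
  rw [cls_mul, classMap_cls, classMap_cls, classMap_cls, ← clsOf_mul]
  refine clsOf_eq_iff.2 <| DefBij.reindex ((Equiv.sumProdDistrib (Fin n) (Fin m) κ).symm.trans
    (finSumFinEquiv.prodCongr (Equiv.refl κ))) (hi.def_image (def_prod hS hT)) fun w => ?_
  constructor
  · rintro ⟨x, ⟨h1, h2⟩, rfl⟩
    exact ⟨⟨_, h1, rfl⟩, ⟨_, h2, rfl⟩⟩
  · rintro ⟨⟨x, hx, h1⟩, ⟨y, hy, h2⟩⟩
    refine ⟨Fin.append x y, ⟨by rwa [append_comp_castAdd], by rwa [append_comp_natAdd]⟩, ?_⟩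
    funext ⟨c, k⟩
    induction c using Fin.addCases with
    | left c => simpa [tupleMap] using congrFun h1 (c, k)
    | right c => simpa [tupleMap] using congrFun h2 (c, k)

/-- If the composite of two codings is definable, then the sets of the codes of codes are in
definable bijection with the original sets. -/
lemma IsCoding.classMap_classMap {i : M → κ → N} {j : N → lam → M} (hi : IsCoding L L' i)
    (hj : IsCoding L' L j)
    (hij : Def L {v : Unit ⊕ κ × lam → M | v ∘ Sum.inr = tupleMap j (i (v (.inl ())))})
    (a : DefClass L M) : hj.classMap (hi.classMap a) = a := by
  induction a using cls_ind with | h n S hS => ?_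
  rw [classMap_cls, classMap_clsOf, ← clsOf_eq_cls hS, clsOf_eq_iff]
  refine DefBij.symm ⟨fun x => tupleMap j (tupleMap i x), ⟨?_, ?_, ?_⟩, ?_⟩
  · exact fun x hx => ⟨_, ⟨x, hx, rfl⟩, rfl⟩
  · exact fun x _ y _ h =>
      tupleMap_injective hi.injective (tupleMap_injective hj.injective h)
  · rintro _ ⟨_, ⟨x, hx, rfl⟩, rfl⟩
    exact ⟨x, hx, rfl⟩
  · have h : ∀ a : Fin n, Def L {v : Fin n ⊕ (Fin n × κ) × lam → M |
        (v ∘ fun p : κ × lam => Sum.inr ((a, p.1), p.2)) = tupleMap j (i (v (.inl a)))} := fun a =>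
      hij.preimage_comp (Sum.elim (fun _ => Sum.inl a) fun p => Sum.inr ((a, p.1), p.2) :
        Unit ⊕ κ × lam → Fin n ⊕ (Fin n × κ) × lam)
    convert (def_comp_mem hS Sum.inl).inter (definable_iInter_of_finite h) using 1
    ext v
    refine and_congr Iff.rfl ?_
    simp only [mem_iInter, mem_ofPred_eq]
    constructor
    · exact fun h a => funext fun p => congrFun h ((a, p.1), p.2)
    · exact fun h => funext fun p => congrFun (h p.1.1) (p.1.2, p.2)

/-- Structures that are coded in each other in such a way that both composites are definable have
isomorphic semirings of definable sets. -/
noncomputable def defClassEquiv {i : M → κ → N} {j : N → lam → M} (hi : IsCoding L L' i)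
    (hj : IsCoding L' L j)
    (hij : Def L {v : Unit ⊕ κ × lam → M | v ∘ Sum.inr = tupleMap j (i (v (.inl ())))})
    (hji : Def L' {v : Unit ⊕ lam × κ → N | v ∘ Sum.inr = tupleMap i (j (v (.inl ())))}) :
    DefClass L M ≃+* DefClass L' N where
  toFun := hi.classMap
  invFun := hj.classMap
  left_inv := hi.classMap_classMap hj hij
  right_inv := hj.classMap_classMap hi hji
  map_add' := hi.classMap_add
  map_mul' := hi.classMap_mul

/-- Isomorphic semirings have isomorphic Grothendieck rings. -/
def GrothendieckRing.congr {R : Type w} {R' : Type w'} [CommSemiring R] [CommSemiring R']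
    (e : R ≃+* R') : GrothendieckRing R ≃+* GrothendieckRing R' where
  toEquiv := Quotient.congr (e.toEquiv.prodCongr e.toEquiv) fun x y => by
    change (∃ c, x.1 + y.2 + c = y.1 + x.2 + c) ↔ ∃ c, e x.1 + e y.2 + c = e y.1 + e x.2 + c
    rw [e.surjective.exists]
    simp only [← map_add, e.injective.eq_iff]
  map_add' x y := by
    induction x using diff_ind with | h a b => ?_
    induction y using diff_ind with | h c d => ?_
    exact congrArg₂ diff (map_add e a c) (map_add e b d)
  map_mul' x y := by
    induction x using diff_ind with | h a b => ?_
    induction y using diff_ind with | h c d => ?_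
    refine congrArg₂ diff ?_ ?_ <;> exact (map_add e _ _).trans (by rw [map_mul, map_mul]; rfl)

end Induced

/-! ### Adjoining a point to an order -/

section Order

instance : ltLang.IsRelational := fun _ => inferInstanceAs (IsEmpty Empty)

lemma def_lt {M γ : Type*} [LT M] (a b : γ) : Def ltLang {v : γ → M | v a < v b} := by
  refine definable_iff_exists_formula_sum.2 ⟨Relations.formula
    (show ltLang.Relations 2 from LtRel.lt) ![Term.var (.inr a), Term.var (.inr b)], ?_⟩
  ext v
  exact Iff.rfl

lemma def_coord_eq_const {L : FirstOrder.Language.{u, v}} {M : Type w} [L.Structure M]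
    {γ : Type*} (a : γ) (c : M) : Def L {v : γ → M | v a = c} :=
  (DefinableFun.proj L).ofPred_eq_const (mem_univ c)

lemma def_prop {L : FirstOrder.Language.{u, v}} {M : Type w} [L.Structure M] {γ : Type*}
    (A : Prop) : Def L {_v : γ → M | A} := by
  by_cases h : A <;> simp [h]

/-- For the signature `{<}` it is enough that the set of codes and the relation `<` on codes are
definable. -/
lemma isCoding_ltLang {M N : Type*} {κ : Type} [LT M] [LT N] [Finite κ] {i : M → κ → N}
    (hi : Function.Injective i) (hr : Def ltLang (range i)) {T : Set (Fin 2 × κ → N)}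
    (hT : Def ltLang T) (h : ∀ x : Fin 2 → M, x 0 < x 1 ↔ tupleMap i x ∈ T) :
    IsCoding ltLang ltLang i :=
  isCoding_of_isRelational hi hr fun _ r => match r with
    | LtRel.lt => ⟨T, hT, h⟩

variable {P : Type u} {P' : Type v}

/-- An order is coded in the order obtained by adjoining one point by its embedding. -/
lemma isCoding_embedding [LT P] [LT P'] {e : P → P'} {c : P'} (he : Function.Injective e)
    (hlt : ∀ x y, e x < e y ↔ x < y) (hc : ∀ y, y ∈ range e ↔ y ≠ c) :
    IsCoding ltLang ltLang fun x (_ : Unit) => e x := by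
  refine isCoding_ltLang (fun x y h => he (congrFun h ())) ?_ (def_lt (0, ()) (1, ()))
    fun x => (hlt _ _).symm
  convert (def_coord_eq_const (L := ltLang) () c).compl using 1
  ext w
  refine Iff.trans ?_ (hc (w ()))
  exact ⟨fun ⟨x, h⟩ => ⟨x, congrFun h ()⟩, fun ⟨x, h⟩ => ⟨x, funext fun _ => h⟩⟩

variable [Nontrivial P]

/-- If `P'` arises from `P` by adjoining one point along `e : P → P'`, then the elements of `P'` are
coded by pairs from `P`: the entry at `false` tells whether the element comes from `P` or is the new
point, and the entry at `true` is the element itself, or a dummy value for the new point. -/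
noncomputable def pointCode (e : P → P') : P' → Bool → P :=
  Function.extend e (fun x b => bif b then x else pt₀ P) fun _ b => bif b then pt₀ P else pt₁ P

lemma pointCode_apply {e : P → P'} (he : Function.Injective e) (x : P) :
    pointCode e (e x) = fun b => bif b then x else pt₀ P :=
  he.extend_apply _ _ _

lemma pointCode_apply_of_notMem {e : P → P'} {c : P'} (hc : c ∉ range e) :
    pointCode e c = fun b => bif b then pt₀ P else pt₁ P :=
  Function.extend_apply' _ _ _ hc

/-- An order `P'` that arises from `P` by adjoining one point, in any position that is the
same relative to all the other elements, is coded in `P` by `pointCode`. -/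
lemma isCoding_pointCode [LT P] [LT P'] {e : P → P'} {c : P'} {A B C : Prop}
    (he : Function.Injective e) (hlt : ∀ x y, e x < e y ↔ x < y) (hc : ∀ y, y ∈ range e ↔ y ≠ c)
    (hA : ∀ x, c < e x ↔ A) (hB : ∀ x, e x < c ↔ B) (hC : c < c ↔ C) :
    IsCoding ltLang ltLang (pointCode e) := by
  have hc' : c ∉ range e := fun h => (hc c).1 h rfl
  have hcases : ∀ y, y = c ∨ ∃ x, e x = y := fun y => or_iff_not_imp_left.2 (hc y).2
  have hne := pt_ne P
  have hne' := (pt_ne P).symm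
  have h0 := pointCode_apply he
  have h1 := pointCode_apply_of_notMem hc'
  have k (l : Fin 2) (p : P) : Def ltLang {w : Fin 2 × Bool → P | w (l, false) = p} :=
    def_coord_eq_const _ _
  refine isCoding_ltLang ?_ ?_
    ((((k 0 (pt₀ P)).inter (k 1 (pt₀ P))).inter (def_lt (0, true) (1, true))).union
      ((((k 0 (pt₀ P)).inter (k 1 (pt₁ P))).inter (def_prop B)).union
        ((((k 0 (pt₁ P)).inter (k 1 (pt₀ P))).inter (def_prop A)).union
          (((k 0 (pt₁ P)).inter (k 1 (pt₁ P))).inter (def_prop C))))) ?_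
  · intro y z h
    have ht := congrFun h true
    have hf := congrFun h false
    rcases hcases y with rfl | ⟨x, rfl⟩ <;> rcases hcases z with rfl | ⟨x', rfl⟩ <;>
      simp_all
  · convert (def_coord_eq_const (L := ltLang) false (pt₀ P)).union
      ((def_coord_eq_const true (pt₀ P)).inter (def_coord_eq_const false (pt₁ P))) using 1
    ext w
    constructor
    · rintro ⟨y, rfl⟩
      rcases hcases y with rfl | ⟨x, rfl⟩ <;> simp [h0, h1]
    · rintro (h | ⟨h, h'⟩)
      · refine ⟨e (w true), (h0 _).trans (funext fun b => ?_)⟩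
        cases b
        · exact Eq.symm h
        · rfl
      · refine ⟨c, h1.trans (funext fun b => ?_)⟩
        cases b
        · exact Eq.symm h'
        · exact Eq.symm h
  · have key (y z : P') : y < z ↔
        ((pointCode e y false = pt₀ P ∧ pointCode e z false = pt₀ P) ∧
          pointCode e y true < pointCode e z true) ∨
        ((pointCode e y false = pt₀ P ∧ pointCode e z false = pt₁ P) ∧ B) ∨
        ((pointCode e y false = pt₁ P ∧ pointCode e z false = pt₀ P) ∧ A) ∨
        ((pointCode e y false = pt₁ P ∧ pointCode e z false = pt₁ P) ∧ C) := by
      rcases hcases y with rfl | ⟨a, rfl⟩ <;> rcases hcases z with rfl | ⟨b, rfl⟩ <;>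
        simp [h0, h1, hne, hne', hlt, hA, hB, hC]
    exact fun x => key (x 0) (x 1)

/-- Adjoining one point to an order, in the same position relative to all the other elements, does
not change the Grothendieck ring. -/
theorem nonempty_K₀_equiv_of_adjoin_point [LT P] [LT P'] [Nontrivial P'] {e : P → P'} {c : P'}
    {A B C : Prop} (he : Function.Injective e) (hlt : ∀ x y, e x < e y ↔ x < y)
    (hc : ∀ y, y ∈ range e ↔ y ≠ c) (hA : ∀ x, c < e x ↔ A) (hB : ∀ x, e x < c ↔ B)
    (hC : c < c ↔ C) : Nonempty (K₀ ltLang P' ≃+* K₀ ltLang P) := by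
  have hc' : c ∉ range e := fun h => (hc c).1 h rfl
  have hu (p : Unit → Prop) : (∀ a, p a) ↔ p () := ⟨fun h => h _, fun h _ => h⟩
  refine ⟨GrothendieckRing.congr (defClassEquiv (isCoding_pointCode he hlt hc hA hB hC)
    (isCoding_embedding he hlt hc) ?_ ?_)⟩
  · convert ((def_coord_eq_const (L := ltLang) (Sum.inl ()) c).inter
      ((def_coord_eq_const (Sum.inr (true, ())) (e (pt₀ P))).inter
        (def_coord_eq_const (Sum.inr (false, ())) (e (pt₁ P))))).union
      ((def_coord_eq_const (Sum.inl ()) c).compl.inter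
        ((def_coord_eq (Sum.inr (true, ())) (Sum.inl ())).inter
          (def_coord_eq_const (Sum.inr (false, ())) (e (pt₀ P))))) using 1
    ext v
    by_cases h : v (.inl ()) = c
    · simp [h, pointCode_apply_of_notMem hc', funext_iff, hu, tupleMap, and_comm]
    · obtain ⟨x, hx⟩ := (hc _).2 h
      rw [← hx] at h
      simp [h, ← hx, pointCode_apply he, funext_iff, hu, tupleMap, and_comm]
  · convert (def_coord_eq (L := ltLang) (Sum.inr ((), true)) (Sum.inl ())).inter
      (def_coord_eq_const (M := P) (Sum.inr ((), false)) (pt₀ P)) using 1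
    ext v
    simp [pointCode_apply he, funext_iff, hu, tupleMap, and_comm]

theorem nonempty_K₀_withBot_equiv (P : Type u) [LinearOrder P] [Nontrivial P] :
    Nonempty (K₀ ltLang (WithBot P) ≃+* K₀ ltLang P) :=
  nonempty_K₀_equiv_of_adjoin_point (e := WithBot.some) (c := ⊥) (A := True) (B := False)
    (C := False) WithBot.coe_injective (fun _ _ => WithBot.coe_lt_coe)
    (fun _ => WithBot.ne_bot_iff_exists.symm) (by simp) (by simp) (by simp)

theorem nonempty_K₀_withTop_equiv (P : Type u) [LinearOrder P] [Nontrivial P] :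
    Nonempty (K₀ ltLang (WithTop P) ≃+* K₀ ltLang P) :=
  nonempty_K₀_equiv_of_adjoin_point (e := WithTop.some) (c := ⊤) (A := False) (B := True)
    (C := False) WithTop.coe_injective (fun _ _ => WithTop.coe_lt_coe)
    (fun _ => WithTop.ne_top_iff_exists.symm) (by simp) (by simp) (by simp)

end Order

end ModelGrothendieck

theorem theorem5p2 (Q : Type*) [LinearOrder Q] [DenselyOrdered Q] [NoMinOrder Q]
    [NoMaxOrder Q] [Nonempty Q] :
    Nonempty (ModelGrothendieck.K₀ ModelGrothendieck.ltLang (WithBot Q) ≃+*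
        ModelGrothendieck.K₀ ModelGrothendieck.ltLang Q) ∧
      Nonempty (ModelGrothendieck.K₀ ModelGrothendieck.ltLang (WithTop Q) ≃+*
        ModelGrothendieck.K₀ ModelGrothendieck.ltLang Q) ∧
      Nonempty (ModelGrothendieck.K₀ ModelGrothendieck.ltLang (WithBot (WithTop Q)) ≃+*
        ModelGrothendieck.K₀ ModelGrothendieck.ltLang Q) := by
  obtain ⟨f⟩ := ModelGrothendieck.nonempty_K₀_withTop_equiv Q
  obtain ⟨g⟩ := ModelGrothendieck.nonempty_K₀_withBot_equiv (WithTop Q)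
  exact ⟨ModelGrothendieck.nonempty_K₀_withBot_equiv Q, ⟨f⟩, ⟨g.trans f⟩⟩
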